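/- Let $\mathcal R=K[x_1,\dots,x_n]$ over a field $K$ with a monomial order $<$, let $f_1,\dots,f_r\in\mathcal R$, and write $\overline{\alpha}=\sum_i a_if_i$ for $\alpha=\sum_i a_ie_i\in\mathcal R^r$. Order the module monomials of $\mathcal R^r$ position over term: $x^ue_i<x^ve_j$ iff $i<j$, or $i=j$ and $x^u<x^v$. The signature $\mathfrak s(\alpha)$ of $\alpha\ne0$ is its largest module monomial, up to non-zero scalars, and $\mathrm{hd}$ denotes the lead term of a polynomial. Monomials may have any non-zero coefficient. For $\alpha$ with $\overline\alpha\neq0$, a multiple $b\beta$ ($b$ a monomial) is a regular top s-reducer of $\alpha$ if $\mathrm{hd}(\overline{b\beta})=\mathrm{hd}(\overline\alpha)$ and $\mathfrak s(b\beta)<\mathfrak s(\alpha)$; regular s-reduction steps of other terms of $\overline\alpha$ are defined in the same way. For $\overline\alpha,\overline\beta\ne0$ and $\lambda=\mathrm{lcm}(\mathrm{hd}(\overline\alpha),\mathrm{hd}(\overline\beta))$ (monic), the S-pair of $\alpha,\beta$ is $a\alpha-b\beta$ with $a=\lambda/\mathrm{hd}(\overline\alpha)$, $b=\lambda/\mathrm{hd}(\overline\beta)$;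 it is regular if $\mathfrak s(a\alpha)\neq\mathfrak s(b\beta)$, and is then written so that $\mathfrak s(a\alpha)>\mathfrak s(b\beta)$. The algorithm G2V maintains a finite sequence $\mathcal G$ of basis elements, listed in the order in which they were added, a set $\mathcal H$ of known syzygies and a pair set $\mathcal P$. Initially $\mathcal G=\emptyset$, $\mathcal H=\{f_ie_j-f_je_i: i<j\}$ and $\mathcal P=\{e_1,\dots,e_r\}$. An element $\delta\in\mathcal G\cup\mathcal H$ is a rewriter in signature $T$ if $\mathfrak s(d\delta)=T$ for some monomial $d$. The canonical rewriter in $T$ is the one that is largest for $\trianglelefteq_{\mathrm{add}}$, the order in which elements of $\mathcal H$ are on top and an element of $\mathcal G$ is larger the later it was added. A multiple $a\alpha$ with $\alpha\in\mathcal G$ is rewritable if $\alpha$ is not the canonical rewriter in signature $\mathfrak s(a\alpha)$. In each step an entry of $\mathcal P$ of smallest signature $T$ is removed from $\mathcal P$. - The entry may be discarded if the canonical rewriter in $T$ exists and is not the generator of larger signature of any regular S-pair in signature $T$ of elements of $\mathcal G$. It has to be discarded if an element of $\mathcal H$ is a rewriter in $T$. - Otherwise it is regular s-reduced with respect to $\mathcal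 G$ to an element $\delta$ that has no regular top s-reducer from $\mathcal G$. If $\overline\delta=0$, then $\delta$ is added to $\mathcal H$. If $\overline\delta\ne0$, then for each regular S-pair $a\alpha-b\beta$ of $\delta$ and an element of $\mathcal G$ only the generator $a\alpha$ of larger signature is put into $\mathcal P$, only one entry of $\mathcal P$ is kept per signature (any choice of which one is allowed), and $\delta$ is added to $\mathcal G$. At any time regular Koszul syzygies $\overline\beta\alpha-\overline\alpha\beta$ with $\alpha,\beta\in\mathcal G$ and $\mathfrak s(\overline\beta\alpha)\ne\mathfrak s(\overline\alpha\beta)$ may be added to $\mathcal H$. **Statement.** Consider any moment of a run of G2V at which an entry $a\alpha\in\mathcal P$ is next to be handled, that is, $\mathfrak s(a\alpha)$ is smallest in $\mathcal P$. Let $\alpha,\beta\in\mathcal G$ and let $a\alpha-b\beta$ be a regular S-pair with $\mathfrak s(a\alpha)>\mathfrak s(b\beta)$. Suppose that there is another element $\gamma\in\mathcal G$, $\gamma\ne\beta$, and a monomial $c$ such that $c\gamma$ is a regular top s-reducer of $a\alpha$ that is not rewritable at this moment. Then $b\beta$ is rewritable at this moment. -/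

import Mathlib

open MvPolynomial

noncomputable section

namespace G2V

/-- The polynomial ring `K[x₁, …, xₙ]`. -/
abbrev Poly (K : Type*) [Field K] (n : ℕ) : Type _ := MvPolynomial (Fin n) K

/-- The free module `R^r` over `R = K[x₁, …, xₙ]`. -/
abbrev Mod (K : Type*) [Field K] (n r : ℕ) : Type _ := Fin r → Poly K n

variable {K : Type*} [Field K] {n r : ℕ}

/-- The standard basis vector `e_i` of `R^r`. -/
def unitVec (i : Fin r) : Mod K n r := Pi.single i 1

/-- The homomorphism `R^r → R` sending `e_i` to the input polynomial `f_i`. -/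
def proj (f : Fin r → Poly K n) (α : Mod K n r) : Poly K n := ∑ i, α i * f i

/-- A monomial: a polynomial with exactly one term (not necessarily monic). -/
def IsMonomial (a : Poly K n) : Prop := ∃ (d : Fin n →₀ ℕ) (k : K), k ≠ 0 ∧ a = monomial d k

/-- The signature of `α`, up to non-zero scalars: the largest module monomial `x^d e_i` occurring
in `α` for the position-over-term order (first the index `i`, then `d` in the monomial order).
The zero vector has no signature, which is encoded by `⊥`. -/
def sig (m : MonomialOrder (Fin n)) (α : Mod K n r) : WithBot (Fin r ×ₗ m.syn) :=
  Finset.univ.sup fun i => (α i).support.sup fun d =>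
    ((toLex (i, m.toSyn d) : Fin r ×ₗ m.syn) : WithBot (Fin r ×ₗ m.syn))

/-- `b β` is a regular s-reducer of the term of exponent `d` of the polynomial part of `α`. -/
def IsRegularReducerAt (m : MonomialOrder (Fin n)) (f : Fin r → Poly K n)
    (α : Mod K n r) (d : Fin n →₀ ℕ) (b : Poly K n) (β : Mod K n r) : Prop :=
  IsMonomial b ∧ d ∈ (proj f α).support ∧
    m.leadingTerm (proj f (b • β)) = monomial d ((proj f α).coeff d) ∧
    sig m (b • β) < sig m α

/-- `b β` is a regular top s-reducer of `α`: it reduces the lead term of the polynomial part. -/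
def IsRegularTopReducer (m : MonomialOrder (Fin n)) (f : Fin r → Poly K n)
    (α : Mod K n r) (b : Poly K n) (β : Mod K n r) : Prop :=
  IsRegularReducerAt m f α (m.degree (proj f α)) b β

/-- One regular s-reduction step (top or tail) of `α` with respect to the basis `G`. -/
def RegularStep (m : MonomialOrder (Fin n)) (f : Fin r → Poly K n) (G : List (Mod K n r))
    (α α' : Mod K n r) : Prop :=
  ∃ d b, ∃ β ∈ G, IsRegularReducerAt m f α d b β ∧ α' = α - b • β

/-- `γ` is a result of regular s-reducing `α` with respect to `G`. Tail reductions are allowed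
but need not be carried out to the end, so that both full regular s-reduction and regular
top s-reduction are included. -/
def RegularReducesTo (m : MonomialOrder (Fin n)) (f : Fin r → Poly K n) (G : List (Mod K n r))
    (α γ : Mod K n r) : Prop :=
  Relation.ReflTransGen (RegularStep m f G) α γ ∧
    ¬ ∃ b, ∃ β ∈ G, IsRegularTopReducer m f γ b β

/-- `a α - b β` is the S-pair of `α` and `β`, it is regular, and `a α` is its generator of larger
signature. Here `a = λ / hd(α̅)` and `b = λ / hd(β̅)`, lead coefficients included, where `λ` is the
monic least common multiple of the two lead terms. -/
def IsSPair (m : MonomialOrder (Fin n)) (f : Fin r → Poly K n)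
    (a : Poly K n) (α : Mod K n r) (b : Poly K n) (β : Mod K n r) : Prop :=
  proj f α ≠ 0 ∧ proj f β ≠ 0 ∧
    a = monomial ((m.degree (proj f α) ⊔ m.degree (proj f β)) - m.degree (proj f α))
      (m.leadingCoeff (proj f α))⁻¹ ∧
    b = monomial ((m.degree (proj f α) ⊔ m.degree (proj f β)) - m.degree (proj f β))
      (m.leadingCoeff (proj f β))⁻¹ ∧
    sig m (b • β) < sig m (a • α)

/-- The Koszul syzygy of `α` and `β`. -/
def koszul (f : Fin r → Poly K n) (α β : Mod K n r) : Mod K n r :=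
  proj f β • α - proj f α • β

/-- An entry of the pair set: an input generator `e_i`, or one single generator `a α` of an S-pair.
The other generator of the S-pair is not stored. -/
inductive Entry (K : Type*) [Field K] (n r : ℕ) : Type _
  | gen (i : Fin r) : Entry K n r
  | jpair (a : Poly K n) (α : Mod K n r) : Entry K n r

/-- The module element represented by an entry of the pair set. -/
def Entry.val : Entry K n r → Mod K n r
  | .gen i => unitVec i
  | .jpair a α => a • α

/-- A state of the algorithm: the basis `G` (listed in the order in which the elements were added),
the known syzygies `H`, and the pair set `P`. -/
structure State (K : Type*) [Field K] (n r : ℕ) where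
  G : List (Mod K n r)
  H : Set (Mod K n r)
  P : Set (Entry K n r)

/-- `α` was added to the list `G` before `β`. -/
def AddedBefore (G : List (Mod K n r)) (α β : Mod K n r) : Prop :=
  ∃ i j : ℕ, i < j ∧ G[i]? = some α ∧ G[j]? = some β

/-- The rewrite order `⊴_add` on `G ∪ H`: syzygies are on top, and basis elements are compared by
the time at which they were added to `G`. -/
def AddLE (s : State K n r) (α β : Mod K n r) : Prop :=
  β ∈ s.H ∨ α = β ∨ AddedBefore s.G α β

/-- `α ∈ G ∪ H` is a rewriter in signature `T`: some monomial multiple of `α` has signature `T`. -/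
def IsRewriter (m : MonomialOrder (Fin n)) (s : State K n r) (T : WithBot (Fin r ×ₗ m.syn))
    (α : Mod K n r) : Prop :=
  (α ∈ s.G ∨ α ∈ s.H) ∧ ∃ a : Poly K n, IsMonomial a ∧ sig m (a • α) = T

/-- `α` is the canonical, that is `⊴_add`-maximal, rewriter in signature `T`. -/
def IsCanonicalRewriter (m : MonomialOrder (Fin n)) (s : State K n r)
    (T : WithBot (Fin r ×ₗ m.syn)) (α : Mod K n r) : Prop :=
  IsRewriter m s T α ∧ ∀ γ, IsRewriter m s T γ → AddLE s γ α

/-- The multiple `a α` is rewritable: `α` is not the canonical rewriter in its signature. -/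
def Rewritable (m : MonomialOrder (Fin n)) (s : State K n r) (a : Poly K n)
    (α : Mod K n r) : Prop :=
  ¬ IsCanonicalRewriter m s (sig m (a • α)) α

/-- The entry `p` is next to be handled: pairs are handled by increasing signature. -/
def IsNext (m : MonomialOrder (Fin n)) (s : State K n r) (p : Entry K n r) : Prop :=
  p ∈ s.P ∧ ∀ q ∈ s.P, sig m p.val ≤ sig m q.val

/-- The stored generators of the regular S-pairs between a new basis element `γ` and `G`. -/
def newPairs (m : MonomialOrder (Fin n)) (f : Fin r → Poly K n) (G : List (Mod K n r))
    (γ : Mod K n r) : Set (Entry K n r) :=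
  {p | ∃ a α b β, IsSPair m f a α b β ∧ p = .jpair a α ∧
    ((α = γ ∧ β ∈ G) ∨ (α ∈ G ∧ β = γ))}

/-- `P'` keeps, for each signature occurring in `Q`, exactly one entry of `Q`. Which one is kept is
left open, so keeping the most recently generated pair, or the one whose basis element was added
last, are both included. -/
def KeepsOnePerSignature (m : MonomialOrder (Fin n)) (Q P' : Set (Entry K n r)) : Prop :=
  P' ⊆ Q ∧ ∀ p ∈ Q, ∃! q, q ∈ P' ∧ sig m q.val = sig m p.val

/-- The canonical rewriter in signature `T` exists and is not the generator of larger signature of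
any S-pair in signature `T`. In other words, each S-pair in signature `T` has a rewritable first
generator. In particular this holds if a multiple of a known syzygy has signature `T`. -/
def Superfluous (m : MonomialOrder (Fin n)) (f : Fin r → Poly K n) (s : State K n r)
    (T : WithBot (Fin r ×ₗ m.syn)) : Prop :=
  ∃ δ, IsCanonicalRewriter m s T δ ∧
    ∀ a, ∀ α ∈ s.G, ∀ b, ∀ β ∈ s.G, IsSPair m f a α b β → sig m (a • α) = T → α ≠ δ

/-- The initial state: all input generators are pending and the principal syzygies are known. -/
def initial (f : Fin r → Poly K n) : State K n r where
  G := []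
  H := {σ | ∃ i j : Fin r, i < j ∧ σ = f i • unitVec j - f j • unitVec i}
  P := Set.range Entry.gen

/-- One step of the algorithm. An entry of the smallest signature is taken from the pair set.

* It may be discarded if its signature is superfluous.
* If its signature is not that of a multiple of a known syzygy, it may be regular s-reduced.
  If the result is a syzygy, it is added to `H`. Otherwise the S-pairs with the elements of `G` are
  formed, the result is added to `G`, and the pair set stores one single generator of one single
  pair for each signature.

Moreover regular Koszul syzygies of basis elements may be added to `H` (as is done when the
computation for a new index starts). -/
inductive Step (m : MonomialOrder (Fin n)) (f : Fin r → Poly K n) :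
    State K n r → State K n r → Prop
  | discard (s : State K n r) (p : Entry K n r) (hp : IsNext m s p)
      (hT : Superfluous m f s (sig m p.val)) :
      Step m f s { s with P := s.P \ {p} }
  | addSyzygy (s : State K n r) (p : Entry K n r) (γ : Mod K n r) (hp : IsNext m s p)
      (hH : ∀ η ∈ s.H, ¬ IsRewriter m s (sig m p.val) η)
      (hγ : RegularReducesTo m f s.G p.val γ) (h0 : proj f γ = 0) :
      Step m f s { s with H := insert γ s.H, P := s.P \ {p} }
  | addBasis (s : State K n r) (p : Entry K n r) (γ : Mod K n r) (P' : Set (Entry K n r))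
      (hp : IsNext m s p)
      (hH : ∀ η ∈ s.H, ¬ IsRewriter m s (sig m p.val) η)
      (hγ : RegularReducesTo m f s.G p.val γ) (h0 : proj f γ ≠ 0)
      (hP : KeepsOnePerSignature m ((s.P \ {p}) ∪ newPairs m f s.G γ) P') :
      Step m f s { G := s.G ++ [γ], H := s.H, P := P' }
  | addKoszul (s : State K n r) (α β : Mod K n r) (hα : α ∈ s.G) (hβ : β ∈ s.G)
      (hreg : sig m (proj f β • α) ≠ sig m (proj f α • β)) :
      Step m f s { s with H := insert (koszul f α β) s.H }

/-- The states that occur in a run of the algorithm on the input `f`. -/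
def Reachable (m : MonomialOrder (Fin n)) (f : Fin r → Poly K n) (s : State K n r) : Prop :=
  Relation.ReflTransGen (Step m f) (initial f) s

end G2V

end

/-! Call a basis element superseded in a signature if a later basis element or a known syzygy is
also a rewriter there. Pairs are handled by increasing signature, so the basis is sorted by
signature and syzygies never lie in it; hence a superseded element is not the canonical rewriter.

Throughout a run, for every regular S-pair `a α - b β` of basis elements, an entry of signature
`𝔰(a α)` is still pending or `α` is superseded in `𝔰(a α)`: when the last such entry disappears,
its result supersedes `α`, or the entry was superfluous. Now let two multiples of basis elements
have the same lead monomial and signatures below all pending ones. If the signatures differ, the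
two multiples are, up to scalars, one and the same multiple of a regular S-pair. Its larger
signature is not pending, so its first generator is superseded, there and in every multiple of the
signature. If the signatures agree, only one of the two elements can be the canonical rewriter. -/

namespace G2V

section SignatureOrder

variable {σ ι : Type*} {m : MonomialOrder σ}

/-- Multiplication of signatures by the monomial `x^t`; the signature `⊥` of zero is fixed. -/
noncomputable def shift (m : MonomialOrder σ) (t : σ →₀ ℕ) :
    WithBot (ι ×ₗ m.syn) → WithBot (ι ×ₗ m.syn) :=
  WithBot.map fun T => toLex ((ofLex T).1, m.toSyn t + (ofLex T).2)

theorem shift_coe (t d : σ →₀ ℕ) (i : ι) :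
    shift m t ((toLex (i, m.toSyn d) : ι ×ₗ m.syn) : WithBot (ι ×ₗ m.syn)) =
      ((toLex (i, m.toSyn (t + d)) : ι ×ₗ m.syn) : WithBot (ι ×ₗ m.syn)) := by
  simp [shift]

theorem shift_zero (T : WithBot (ι ×ₗ m.syn)) : shift m 0 T = T := by
  cases T <;> simp [shift]

theorem shift_add (t u : σ →₀ ℕ) (T : WithBot (ι ×ₗ m.syn)) :
    shift m (t + u) T = shift m t (shift m u T) := by
  cases T <;> simp [shift, add_assoc]

theorem shift_strictMono [PartialOrder ι] (t : σ →₀ ℕ) :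
    StrictMono (shift m t : WithBot (ι ×ₗ m.syn) → WithBot (ι ×ₗ m.syn)) := by
  refine StrictMono.withBot_map fun S T hST => ?_
  rw [Prod.Lex.lt_iff] at hST ⊢
  simpa using hST

theorem lt_shift [PartialOrder ι] {t : σ →₀ ℕ} (ht : t ≠ 0) {T : WithBot (ι ×ₗ m.syn)}
    (hT : T ≠ ⊥) : T < shift m t T := by
  cases T with
  | bot => exact absurd rfl hT
  | coe T =>
    refine WithBot.coe_lt_coe.mpr (Prod.Lex.lt_iff.mpr (Or.inr ⟨rfl, ?_⟩))
    simpa using m.toSyn_lt_iff_ne_zero.mpr ((m.toSyn_eq_zero_iff t).not.mpr ht)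

theorem le_shift [PartialOrder ι] (t : σ →₀ ℕ) (T : WithBot (ι ×ₗ m.syn)) : T ≤ shift m t T := by
  rcases eq_or_ne t 0 with rfl | ht
  · rw [shift_zero]
  · rcases eq_or_ne T ⊥ with rfl | hT
    · exact bot_le
    · exact (lt_shift ht hT).le

end SignatureOrder

theorem support_monomial_mul {σ R : Type*} [CommSemiring R] [NoZeroDivisors R] (t : σ →₀ ℕ)
    {k : R} (hk : k ≠ 0) (p : MvPolynomial σ R) :
    (monomial t k * p).support = p.support.map (addLeftEmbedding t) :=
  AddMonoidAlgebra.support_coeff_single_mul p k (fun _ => by simp [hk]) t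

theorem inv_leadingCoeff_ne_zero {σ F : Type*} [Field F] {m : MonomialOrder σ}
    {p : MvPolynomial σ F} (hp : p ≠ 0) : (m.leadingCoeff p)⁻¹ ≠ 0 :=
  inv_ne_zero (m.leadingCoeff_ne_zero_iff.mpr hp)

theorem exists_eq_add_sup_tsub {M : Type*} [AddCommMonoid M] [SemilatticeSup M]
    [CanonicallyOrderedAdd M] [IsOrderedCancelAddMonoid M] [Sub M] [OrderedSub M] {t u d e : M}
    (h : t + d = u + e) : ∃ w, t = w + (d ⊔ e - d) ∧ u = w + (d ⊔ e - e) := by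
  have hle : d ⊔ e ≤ t + d := sup_le le_add_self (h ▸ le_add_self)
  refine ⟨t + d - d ⊔ e, add_right_cancel (b := d) ?_, add_right_cancel (b := e) ?_⟩
  · rw [add_assoc, tsub_add_cancel_of_le le_sup_left, tsub_add_cancel_of_le hle]
  · rw [add_assoc, tsub_add_cancel_of_le le_sup_right, tsub_add_cancel_of_le hle, h]

variable {K : Type*} [Field K] {n r : ℕ} {m : MonomialOrder (Fin n)} {f : Fin r → Poly K n}

section Signature

theorem sig_le_iff {α : Mod K n r} {T : WithBot (Fin r ×ₗ m.syn)} :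
    sig m α ≤ T ↔ ∀ i d, (α i).coeff d ≠ 0 → ((toLex (i, m.toSyn d) : Fin r ×ₗ m.syn) :
      WithBot (Fin r ×ₗ m.syn)) ≤ T := by
  simp [sig, Finset.sup_le_iff]

theorem coe_le_sig {α : Mod K n r} {i : Fin r} {d : Fin n →₀ ℕ} (h : (α i).coeff d ≠ 0) :
    ((toLex (i, m.toSyn d) : Fin r ×ₗ m.syn) : WithBot (Fin r ×ₗ m.syn)) ≤ sig m α :=
  sig_le_iff.mp le_rfl i d h

theorem sig_eq_bot_iff {α : Mod K n r} : sig m α = ⊥ ↔ α = 0 := by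
  refine ⟨fun h => ?_, fun h => by simp [h, sig]⟩
  ext i d
  by_contra hd
  exact WithBot.coe_ne_bot (le_bot_iff.mp (h ▸ coe_le_sig hd))

theorem sig_neg (α : Mod K n r) : sig m (-α) = sig m α := by
  simp [sig]

theorem sig_add_le (α β : Mod K n r) : sig m (α + β) ≤ sig m α ⊔ sig m β := by
  refine sig_le_iff.mpr fun i d hd => ?_
  by_cases hα : (α i).coeff d = 0
  · exact le_sup_of_le_right (coe_le_sig (by simpa [hα] using hd))
  · exact le_sup_of_le_left (coe_le_sig hα)

theorem sig_sub_eq_of_lt {α β : Mod K n r} (h : sig m β < sig m α) :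
    sig m (α - β) = sig m α := by
  apply le_antisymm
  · calc sig m (α - β) ≤ sig m α ⊔ sig m (-β) := sub_eq_add_neg α β ▸ sig_add_le α (-β)
      _ = sig m α := by rw [sig_neg, sup_eq_left.mpr h.le]
  · have hsup : sig m α ≤ sig m (α - β) ⊔ sig m β := by
      simpa only [sub_add_cancel] using sig_add_le (m := m) (α - β) β
    exact (le_sup_iff.mp hsup).resolve_right h.not_ge

theorem sig_monomial_smul (t : Fin n →₀ ℕ) {k : K} (hk : k ≠ 0) (α : Mod K n r) :
    sig m (monomial t k • α) = shift m t (sig m α) := by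
  have hmono := (shift_strictMono (m := m) (ι := Fin r) t).monotone
  unfold sig
  rw [Finset.apply_sup_eq_sup_comp_of_linearOrder _ hmono rfl]
  refine Finset.sup_congr rfl fun i _ => ?_
  rw [Function.comp_apply, Finset.apply_sup_eq_sup_comp_of_linearOrder _ hmono rfl,
    Pi.smul_apply, smul_eq_mul, support_monomial_mul t hk, Finset.sup_map]
  exact Finset.sup_congr rfl fun d _ => (shift_coe t d i).symm

theorem sig_monomial_add_smul (t u : Fin n →₀ ℕ) {k l : K} (hk : k ≠ 0) (hl : l ≠ 0)
    (α : Mod K n r) : sig m (monomial (t + u) k • α) = shift m t (sig m (monomial u l • α)) := by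
  rw [sig_monomial_smul _ hk, sig_monomial_smul _ hl, shift_add]

theorem sig_unitVec (i : Fin r) : sig m (unitVec i : Mod K n r) =
    ((toLex (i, 0) : Fin r ×ₗ m.syn) : WithBot (Fin r ×ₗ m.syn)) := by
  apply le_antisymm
  · refine sig_le_iff.mpr fun j d hd => ?_
    obtain rfl : j = i := by
      by_contra hji
      simp [unitVec, hji] at hd
    obtain rfl : d = 0 := by
      by_contra hd0
      simp [unitVec, coeff_one, Ne.symm hd0] at hd
    rw [map_zero]
  · have h : ((unitVec i : Mod K n r) i).coeff 0 ≠ 0 := by simp [unitVec]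
    simpa only [map_zero] using coe_le_sig (m := m) h

end Signature

section PolynomialPart

theorem proj_smul (b : Poly K n) (α : Mod K n r) : proj f (b • α) = b * proj f α := by
  simp [proj, Finset.mul_sum, mul_assoc]

theorem proj_sub (α β : Mod K n r) : proj f (α - β) = proj f α - proj f β := by
  simp [proj, sub_mul]

theorem proj_unitVec (i : Fin r) : proj f (unitVec i) = f i := by
  simp [proj, unitVec, Pi.single_apply]

theorem ne_zero_of_proj_ne_zero {α : Mod K n r} (h : proj f α ≠ 0) : α ≠ 0 := by
  rintro rfl
  simp [proj] at h

theorem proj_koszul (α β : Mod K n r) : proj f (koszul f α β) = 0 := by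
  rw [koszul, proj_sub, proj_smul, proj_smul, mul_comm, sub_self]

theorem degree_proj_monomial_smul (t : Fin n →₀ ℕ) {k : K} (hk : k ≠ 0) {α : Mod K n r}
    (h : proj f α ≠ 0) : m.degree (proj f (monomial t k • α)) = t + m.degree (proj f α) := by
  classical
  rw [proj_smul, m.degree_mul (monomial_eq_zero.not.mpr hk) h, m.degree_monomial, if_neg hk]

end PolynomialPart

section Reduction

theorem IsRegularReducerAt.sig_lt {α β : Mod K n r} {d : Fin n →₀ ℕ} {b : Poly K n}
    (h : IsRegularReducerAt m f α d b β) : sig m (b • β) < sig m α :=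
  h.2.2.2

theorem IsRegularReducerAt.degree_eq {α β : Mod K n r} {d : Fin n →₀ ℕ} {b : Poly K n}
    (h : IsRegularReducerAt m f α d b β) : m.degree (proj f (b • β)) = d := by
  classical
  obtain ⟨-, hd, hlead, -⟩ := h
  rw [← m.degree_leadingTerm, hlead, m.degree_monomial, if_neg (mem_support_iff.mp hd)]

theorem RegularReducesTo.sig_eq {G : List (Mod K n r)} {α γ : Mod K n r}
    (h : RegularReducesTo m f G α γ) : sig m γ = sig m α := by
  obtain ⟨hsteps, -⟩ := h
  induction hsteps with
  | refl => rfl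
  | tail _ hstep ih =>
    obtain ⟨d, b, β, -, hred, rfl⟩ := hstep
    rw [sig_sub_eq_of_lt hred.sig_lt, ih]

end Reduction

section SPair

variable {a b : Poly K n} {α β : Mod K n r}

theorem IsSPair.sig_lt (h : IsSPair m f a α b β) : sig m (b • β) < sig m (a • α) :=
  h.2.2.2.2

theorem IsSPair.isMonomial_left (h : IsSPair m f a α b β) : IsMonomial a :=
  ⟨_, _, inv_leadingCoeff_ne_zero h.1, h.2.2.1⟩

theorem IsSPair.isMonomial_right (h : IsSPair m f a α b β) : IsMonomial b :=
  ⟨_, _, inv_leadingCoeff_ne_zero h.2.1, h.2.2.2.1⟩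

theorem not_isSPair_self : ¬ IsSPair m f a α b α := by
  rintro ⟨-, -, rfl, rfl, hlt⟩
  exact hlt.false

theorem IsSPair.degree_eq (h : IsSPair m f a α b β) :
    m.degree (proj f (a • α)) = m.degree (proj f (b • β)) := by
  obtain ⟨hα, hβ, rfl, rfl, -⟩ := h
  rw [degree_proj_monomial_smul _ (inv_leadingCoeff_ne_zero hα) hα,
    degree_proj_monomial_smul _ (inv_leadingCoeff_ne_zero hβ) hβ,
    tsub_add_cancel_of_le le_sup_left, tsub_add_cancel_of_le le_sup_right]

theorem exists_isSPair_of_degree_eq (hα : proj f α ≠ 0) (hβ : proj f β ≠ 0) (ha : IsMonomial a)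
    (hb : IsMonomial b) (hdeg : m.degree (proj f (a • α)) = m.degree (proj f (b • β)))
    (hlt : sig m (b • β) < sig m (a • α)) :
    ∃ a' b' t, IsSPair m f a' α b' β ∧ sig m (a • α) = shift m t (sig m (a' • α)) := by
  obtain ⟨u, k, hk, rfl⟩ := ha
  obtain ⟨v, l, hl, rfl⟩ := hb
  rw [degree_proj_monomial_smul u hk hα, degree_proj_monomial_smul v hl hβ] at hdeg
  obtain ⟨t, rfl, rfl⟩ := exists_eq_add_sup_tsub hdeg
  have hα' := inv_leadingCoeff_ne_zero (m := m) hα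
  have hβ' := inv_leadingCoeff_ne_zero (m := m) hβ
  rw [sig_monomial_add_smul t _ hk hα', sig_monomial_add_smul t _ hl hβ',
    (shift_strictMono t).lt_iff_lt] at hlt
  exact ⟨_, _, t, ⟨hα, hβ, rfl, rfl, hlt⟩, sig_monomial_add_smul t _ hk hα' α⟩

theorem IsSPair.exists_isRegularTopReducer (h : IsSPair m f a α b β)
    (hle : m.degree (proj f β) ≤ m.degree (proj f α)) :
    ∃ c, IsRegularTopReducer m f α c β := by
  obtain ⟨hα, hβ, rfl, rfl, hlt⟩ := h
  have hα' := inv_leadingCoeff_ne_zero (m := m) hα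
  have hβ' := inv_leadingCoeff_ne_zero (m := m) hβ
  have hk : m.leadingCoeff (proj f α) * (m.leadingCoeff (proj f β))⁻¹ ≠ 0 :=
    mul_ne_zero (m.leadingCoeff_ne_zero_iff.mpr hα) hβ'
  refine ⟨monomial (m.degree (proj f α) - m.degree (proj f β)) _, ⟨_, _, hk, rfl⟩,
    m.degree_mem_support hα, ?_, ?_⟩
  · rw [MonomialOrder.leadingTerm, degree_proj_monomial_smul _ hk hβ, tsub_add_cancel_of_le hle,
      proj_smul, m.leadingCoeff_mul, m.leadingCoeff_monomial,
      inv_mul_cancel_right₀ (m.leadingCoeff_ne_zero_iff.mpr hβ), MonomialOrder.leadingCoeff]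
  · rwa [sup_eq_left.mpr hle, tsub_self, sig_monomial_smul _ hα', shift_zero,
      sig_monomial_smul _ hβ', ← sig_monomial_smul _ hk] at hlt

theorem sig_lt_of_mem_newPairs {G : List (Mod K n r)} {γ : Mod K n r}
    (hγ : ¬ ∃ b, ∃ β ∈ G, IsRegularTopReducer m f γ b β) {p : Entry K n r}
    (hp : p ∈ newPairs m f G γ) : sig m γ < sig m p.val := by
  obtain ⟨a, α, b, β, h, rfl, ⟨rfl, hβ⟩ | ⟨-, rfl⟩⟩ := hp
  · have hnle : ¬ m.degree (proj f β) ≤ m.degree (proj f α) := fun hle =>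
      let ⟨c, hc⟩ := h.exists_isRegularTopReducer hle
      hγ ⟨c, β, hβ, hc⟩
    obtain ⟨hα, -, rfl, -, -⟩ := h
    rw [Entry.val, sig_monomial_smul _ (inv_leadingCoeff_ne_zero hα)]
    refine lt_shift (fun h0 => hnle ?_) (sig_eq_bot_iff.not.mpr (ne_zero_of_proj_ne_zero hα))
    exact le_sup_right.trans (tsub_eq_zero_iff_le.mp h0)
  · obtain ⟨t, k, hk, rfl⟩ := h.isMonomial_right
    calc sig m β ≤ sig m (monomial t k • β) := sig_monomial_smul (m := m) t hk β ▸ le_shift t _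
      _ < sig m (a • α) := h.sig_lt

end SPair

section Rewriting

variable {s s' : State K n r} {T : WithBot (Fin r ×ₗ m.syn)} {α β : Mod K n r}

theorem AddedBefore.mono {G G' : List (Mod K n r)} (h : AddedBefore G α β) (hG : G <+: G') :
    AddedBefore G' α β := by
  have hget {i : ℕ} {δ : Mod K n r} (hi : G[i]? = some δ) : G'[i]? = some δ := by
    obtain ⟨hlt, rfl⟩ := List.getElem?_eq_some_iff.mp hi
    exact List.prefix_iff_getElem?.mp hG i hlt
  obtain ⟨i, j, hij, hi, hj⟩ := h
  exact ⟨i, j, hij, hget hi, hget hj⟩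

theorem AddedBefore.mem_left {G : List (Mod K n r)} (h : AddedBefore G α β) : α ∈ G :=
  let ⟨_, _, _, hi, _⟩ := h
  List.mem_of_getElem? hi

theorem AddedBefore.rel_of_pairwise {G : List (Mod K n r)} {R : Mod K n r → Mod K n r → Prop}
    (h : AddedBefore G α β) (hR : G.Pairwise R) : R α β := by
  obtain ⟨i, j, hij, hi, hj⟩ := h
  obtain ⟨hi', rfl⟩ := List.getElem?_eq_some_iff.mp hi
  obtain ⟨hj', rfl⟩ := List.getElem?_eq_some_iff.mp hj
  exact List.pairwise_iff_getElem.mp hR i j hi' hj' hij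

theorem addedBefore_append_singleton {G : List (Mod K n r)} (hα : α ∈ G) (γ : Mod K n r) :
    AddedBefore (G ++ [γ]) α γ := by
  obtain ⟨i, hi⟩ := List.mem_iff_getElem?.mp hα
  have hlt := (List.getElem?_eq_some_iff.mp hi).1
  exact ⟨i, G.length, hlt, by rwa [List.getElem?_append_left hlt], List.getElem?_concat_length⟩

theorem isRewriter_sig_self (h : α ∈ s.G ∨ α ∈ s.H) : IsRewriter m s (sig m α) α :=
  ⟨h, 1, ⟨0, 1, one_ne_zero, rfl⟩, by rw [one_smul]⟩

theorem IsRewriter.mono (h : IsRewriter m s T α) (hG : s.G ⊆ s'.G) (hH : s.H ⊆ s'.H) :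
    IsRewriter m s' T α :=
  ⟨h.1.imp (fun hα => hG hα) (fun hα => hH hα), h.2⟩

theorem IsRewriter.shift (h : IsRewriter m s T α) (t : Fin n →₀ ℕ) :
    IsRewriter m s (shift m t T) α := by
  obtain ⟨hα, a, ⟨d, k, hk, rfl⟩, rfl⟩ := h
  exact ⟨hα, monomial (t + d) k, ⟨_, k, hk, rfl⟩, sig_monomial_add_smul t d hk hk α⟩

/-- `α` is superseded in signature `T`: there is a rewriter in `T` strictly above `α` in the
rewrite order, that is a syzygy or a basis element added after `α`. -/
def IsSuperseded (m : MonomialOrder (Fin n)) (s : State K n r) (T : WithBot (Fin r ×ₗ m.syn))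
    (α : Mod K n r) : Prop :=
  ∃ η, IsRewriter m s T η ∧ (η ∈ s.H ∨ AddedBefore s.G α η)

theorem IsSuperseded.mono (h : IsSuperseded m s T α) (hG : s.G <+: s'.G) (hH : s.H ⊆ s'.H) :
    IsSuperseded m s' T α :=
  let ⟨η, hη, habove⟩ := h
  ⟨η, hη.mono hG.subset hH, habove.imp (fun h => hH h) (fun h => h.mono hG)⟩

theorem IsSuperseded.shift (h : IsSuperseded m s T α) (t : Fin n →₀ ℕ) :
    IsSuperseded m s (shift m t T) α :=
  let ⟨η, hη, habove⟩ := h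
  ⟨η, hη.shift t, habove⟩

/-- The signature `T` is covered for the basis element `α`: an entry of signature `T` is still
pending or `α` is superseded in `T`. This holds for the larger generators of all regular S-pairs
throughout a run. -/
def IsCovered (m : MonomialOrder (Fin n)) (s : State K n r) (T : WithBot (Fin r ×ₗ m.syn))
    (α : Mod K n r) : Prop :=
  (∃ p ∈ s.P, sig m p.val = T) ∨ IsSuperseded m s T α

end Rewriting

/-- The properties of a state that hold at the beginning and are preserved by every step of the
algorithm. -/
structure Invariant (m : MonomialOrder (Fin n)) (f : Fin r → Poly K n) (s : State K n r) :
    Prop where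
  proj_ne_zero : ∀ α ∈ s.G, proj f α ≠ 0
  proj_eq_zero : ∀ η ∈ s.H, proj f η = 0
  pairwise_sig_lt : s.G.Pairwise fun α β => sig m α < sig m β
  sig_lt_pending : ∀ α ∈ s.G, ∀ p ∈ s.P, sig m α < sig m p.val
  injOn_sig : Set.InjOn (fun p : Entry K n r => sig m p.val) s.P
  isCovered : ∀ a, ∀ α ∈ s.G, ∀ b, ∀ β ∈ s.G, IsSPair m f a α b β →
    IsCovered m s (sig m (a • α)) α

namespace Invariant

variable {s s' : State K n r} {T : WithBot (Fin r ×ₗ m.syn)} {b c : Poly K n} {α β γ : Mod K n r}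

theorem not_mem_syzygies (hs : Invariant m f s) (hα : α ∈ s.G) : α ∉ s.H :=
  fun hH => hs.proj_ne_zero α hα (hs.proj_eq_zero α hH)

theorem sig_lt_of_addedBefore (hs : Invariant m f s) (h : AddedBefore s.G α β) :
    sig m α < sig m β :=
  h.rel_of_pairwise hs.pairwise_sig_lt

theorem not_isCanonicalRewriter (hs : Invariant m f s) (hα : α ∈ s.G)
    (h : IsSuperseded m s T α) : ¬ IsCanonicalRewriter m s T α := by
  rintro ⟨-, hmax⟩
  obtain ⟨η, hη, hηH | hαη⟩ := h
  · rcases hmax η hη with hαH | rfl | hηα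
    · exact hs.not_mem_syzygies hα hαH
    · exact hs.not_mem_syzygies hα hηH
    · exact hs.not_mem_syzygies hηα.mem_left hηH
  · rcases hmax η hη with hαH | rfl | hηα
    · exact hs.not_mem_syzygies hα hαH
    · exact (hs.sig_lt_of_addedBefore hαη).false
    · exact (hs.sig_lt_of_addedBefore hαη).asymm (hs.sig_lt_of_addedBefore hηα)

theorem eq_of_isCanonicalRewriter (hs : Invariant m f s) (hα : α ∈ s.G) (hβ : β ∈ s.G)
    (hcα : IsCanonicalRewriter m s T α) (hcβ : IsCanonicalRewriter m s T β) : α = β := by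
  rcases hcα.2 β hcβ.1 with hαH | hβα | hβα
  · exact absurd hαH (hs.not_mem_syzygies hα)
  · exact hβα.symm
  · exact absurd hcβ (hs.not_isCanonicalRewriter hβ ⟨α, hcα.1, Or.inr hβα⟩)

theorem initial (m : MonomialOrder (Fin n)) (f : Fin r → Poly K n) :
    Invariant m f (initial f) where
  proj_ne_zero := by simp [G2V.initial]
  proj_eq_zero := by
    rintro _ ⟨i, j, -, rfl⟩
    rw [proj_sub, proj_smul, proj_smul, proj_unitVec, proj_unitVec, mul_comm, sub_self]
  pairwise_sig_lt := List.Pairwise.nil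
  sig_lt_pending := by simp [G2V.initial]
  injOn_sig := by
    rintro _ ⟨i, rfl⟩ _ ⟨j, rfl⟩ h
    simp only [Entry.val, sig_unitVec, WithBot.coe_inj, toLex_inj, Prod.mk.injEq, and_true] at h
    rw [h]
  isCovered := by simp [G2V.initial]

theorem of_basis_eq (hs : Invariant m f s) (hG : s'.G = s.G) (hH : s.H ⊆ s'.H)
    (hproj : ∀ η ∈ s'.H, proj f η = 0) (hP : s'.P ⊆ s.P)
    (hdone : ∀ p ∈ s.P, p ∉ s'.P → ∀ a, ∀ α ∈ s.G, ∀ b, ∀ β ∈ s.G, IsSPair m f a α b β →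
      sig m (a • α) = sig m p.val → IsSuperseded m s' (sig m p.val) α) :
    Invariant m f s' where
  proj_ne_zero := hG ▸ hs.proj_ne_zero
  proj_eq_zero := hproj
  pairwise_sig_lt := hG ▸ hs.pairwise_sig_lt
  sig_lt_pending α hα p hp := hs.sig_lt_pending α (hG ▸ hα) p (hP hp)
  injOn_sig := hs.injOn_sig.mono hP
  isCovered a α hα b β hβ h := by
    rw [hG] at hα hβ
    rcases hs.isCovered a α hα b β hβ h with ⟨p, hp, hpa⟩ | hsup
    · by_cases hp' : p ∈ s'.P
      · exact Or.inl ⟨p, hp', hpa⟩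
      · exact Or.inr (hpa ▸ hdone p hp hp' a α hα b β hβ h hpa.symm)
    · exact Or.inr (hsup.mono (hG ▸ List.prefix_rfl) hH)

theorem discard (hs : Invariant m f s) {p : Entry K n r}
    (hT : Superfluous m f s (sig m p.val)) : Invariant m f { s with P := s.P \ {p} } := by
  refine hs.of_basis_eq rfl subset_rfl hs.proj_eq_zero Set.sdiff_subset ?_
  intro q hq hq' a α hα b β hβ h ha
  obtain rfl : q = p := by simpa [hq] using hq'
  obtain ⟨δ, ⟨hδ, hmax⟩, hne⟩ := hT
  refine ⟨δ, hδ, ?_⟩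
  rcases hmax α ⟨Or.inl hα, a, h.isMonomial_left, ha⟩ with hδH | hαδ | hαδ
  · exact Or.inl hδH
  · exact absurd hαδ (hne a α hα b β hβ h ha)
  · exact Or.inr hαδ

theorem addSyzygy (hs : Invariant m f s) {p : Entry K n r} (hγ : sig m γ = sig m p.val)
    (h0 : proj f γ = 0) :
    Invariant m f { s with H := insert γ s.H, P := s.P \ {p} } := by
  refine hs.of_basis_eq rfl (Set.subset_insert γ s.H)
    (Set.forall_mem_insert.mpr ⟨h0, hs.proj_eq_zero⟩) Set.sdiff_subset ?_
  intro q hq hq' _ _ _ _ _ _ _ _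
  obtain rfl : q = p := by simpa [hq] using hq'
  have hmem : γ ∈ insert γ s.H := Set.mem_insert γ s.H
  exact ⟨γ, hγ ▸ isRewriter_sig_self (Or.inr hmem), Or.inl hmem⟩

theorem addKoszul (hs : Invariant m f s) (α β : Mod K n r) :
    Invariant m f { s with H := insert (koszul f α β) s.H } :=
  hs.of_basis_eq rfl (Set.subset_insert _ s.H)
    (Set.forall_mem_insert.mpr ⟨proj_koszul α β, hs.proj_eq_zero⟩) subset_rfl
    fun _ hp hp' => absurd hp hp'

theorem isCovered_append (hs : Invariant m f s) {p : Entry K n r} {P' : Set (Entry K n r)}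
    (hγ : sig m γ = sig m p.val)
    (hP : ∀ q ∈ s.P \ {p} ∪ newPairs m f s.G γ, ∃ q' ∈ P', sig m q'.val = sig m q.val)
    {a : Poly K n} (hα : α ∈ s.G ++ [γ]) (hβ : β ∈ s.G ++ [γ]) (h : IsSPair m f a α b β) :
    IsCovered m { G := s.G ++ [γ], H := s.H, P := P' } (sig m (a • α)) α := by
  rw [List.mem_append, List.mem_singleton] at hα hβ
  rcases hα with hα | rfl <;> rcases hβ with hβ | rfl
  · rcases hs.isCovered a α hα b β hβ h with ⟨q, hq, hqa⟩ | hsup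
    · by_cases hqp : q = p
      · refine Or.inr ⟨γ, ?_, Or.inr (addedBefore_append_singleton hα γ)⟩
        rw [← hqa, hqp, ← hγ]
        exact isRewriter_sig_self (Or.inl List.mem_concat_self)
      · exact Or.inl (hqa ▸ hP q (Or.inl ⟨hq, hqp⟩))
    · exact Or.inr (hsup.mono (List.prefix_append _ _) subset_rfl)
  · exact Or.inl (hP (.jpair a α) (Or.inr ⟨a, α, b, β, h, rfl, Or.inr ⟨hα, rfl⟩⟩))
  · exact Or.inl (hP (.jpair a α) (Or.inr ⟨a, α, b, β, h, rfl, Or.inl ⟨rfl, hβ⟩⟩))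
  · exact absurd h not_isSPair_self

theorem addBasis (hs : Invariant m f s) {p : Entry K n r} {P' : Set (Entry K n r)}
    (hp : IsNext m s p) (hγ : RegularReducesTo m f s.G p.val γ) (h0 : proj f γ ≠ 0)
    (hP : KeepsOnePerSignature m (s.P \ {p} ∪ newPairs m f s.G γ) P') :
    Invariant m f { G := s.G ++ [γ], H := s.H, P := P' } := by
  have hG : ∀ α ∈ s.G, sig m α < sig m γ := fun α hα =>
    hγ.sig_eq ▸ hs.sig_lt_pending α hα p hp.1
  have hP' : ∀ q ∈ P', sig m γ < sig m q.val := by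
    intro q hq
    rcases hP.1 hq with ⟨hq, hqp⟩ | hq
    · exact hγ.sig_eq ▸ (hp.2 q hq).lt_of_ne fun h => hqp (hs.injOn_sig hq hp.1 h.symm)
    · exact sig_lt_of_mem_newPairs hγ.2 hq
  exact {
    proj_ne_zero := List.forall_mem_append.mpr ⟨hs.proj_ne_zero, by simpa using h0⟩
    proj_eq_zero := hs.proj_eq_zero
    pairwise_sig_lt := List.pairwise_append.mpr
      ⟨hs.pairwise_sig_lt, List.pairwise_singleton _ _, by simpa using hG⟩
    sig_lt_pending := List.forall_mem_append.mpr
      ⟨fun α hα q hq => (hG α hα).trans (hP' q hq), by simpa using hP'⟩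
    injOn_sig := fun q₁ h₁ q₂ h₂ h => (hP.2 q₂ (hP.1 h₂)).unique ⟨h₁, h⟩ ⟨h₂, rfl⟩
    isCovered := fun _ _ hα _ _ hβ h =>
      hs.isCovered_append hγ.sig_eq (fun q hq => (hP.2 q hq).exists) hα hβ h }

theorem step (hs : Invariant m f s) (h : Step m f s s') : Invariant m f s' := by
  cases h with
  | discard p _ hT => exact hs.discard hT
  | addSyzygy p γ _ _ hγ h0 => exact hs.addSyzygy hγ.sig_eq h0
  | addBasis p γ P' hp _ hγ h0 hP => exact hs.addBasis hp hγ h0 hP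
  | addKoszul α β _ _ _ => exact hs.addKoszul α β

theorem not_isCanonicalRewriter_of_sig_lt (hs : Invariant m f s) (hb : IsMonomial b)
    (hc : IsMonomial c) (hβ : β ∈ s.G) (hγ : γ ∈ s.G)
    (hdeg : m.degree (proj f (b • β)) = m.degree (proj f (c • γ)))
    (hP : ∀ q ∈ s.P, sig m (b • β) < sig m q.val) (hlt : sig m (c • γ) < sig m (b • β)) :
    ¬ IsCanonicalRewriter m s (sig m (b • β)) β := by
  obtain ⟨b', c', t, hpair, hsig⟩ := exists_isSPair_of_degree_eq
    (hs.proj_ne_zero β hβ) (hs.proj_ne_zero γ hγ) hb hc hdeg hlt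
  have hnot : ¬ ∃ q ∈ s.P, sig m q.val = sig m (b' • β) := by
    rintro ⟨q, hq, hqb⟩
    exact (hP q hq).not_ge (hqb ▸ hsig ▸ le_shift t _)
  have hsup := (hs.isCovered b' β hβ c' γ hγ hpair).resolve_left hnot
  exact hsig ▸ hs.not_isCanonicalRewriter hβ (hsup.shift t)

end Invariant

theorem Reachable.invariant {s : State K n r} (hs : Reachable m f s) : Invariant m f s := by
  induction hs with
  | refl => exact Invariant.initial m f
  | tail _ hstep ih => exact ih.step hstep

end G2V

theorem mainTheorem12_general {K : Type*} [Field K] {n r : ℕ} {m : MonomialOrder (Fin n)}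
    {f : Fin r → G2V.Poly K n} {s : G2V.State K n r} (hs : G2V.Reachable m f s)
    {b c : G2V.Poly K n} {β γ : G2V.Mod K n r} (hb : G2V.IsMonomial b) (hc : G2V.IsMonomial c)
    (hβ : β ∈ s.G) (hγ : γ ∈ s.G) (hne : γ ≠ β)
    (hdeg : m.degree (G2V.proj f (b • β)) = m.degree (G2V.proj f (c • γ)))
    (hbP : ∀ p ∈ s.P, G2V.sig m (b • β) < G2V.sig m p.val)
    (hcP : ∀ p ∈ s.P, G2V.sig m (c • γ) < G2V.sig m p.val)
    (hcan : ¬ G2V.Rewritable m s c γ) :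
    G2V.Rewritable m s b β := by
  intro hbβ
  have hinv := hs.invariant
  have hcγ := not_not.mp hcan
  rcases lt_trichotomy (G2V.sig m (c • γ)) (G2V.sig m (b • β)) with hlt | heq | hgt
  · exact hinv.not_isCanonicalRewriter_of_sig_lt hb hc hβ hγ hdeg hbP hlt hbβ
  · exact hne (hinv.eq_of_isCanonicalRewriter hγ hβ hcγ (heq ▸ hbβ))
  · exact hinv.not_isCanonicalRewriter_of_sig_lt hc hb hγ hβ hdeg.symm hcP hgt hcγ

theorem mainTheorem12 {K : Type*} [Field K] {n r : ℕ} (m : MonomialOrder (Fin n))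
    (f : Fin r → G2V.Poly K n)
    (s : G2V.State K n r) (hs : G2V.Reachable m f s)
    (a b c : G2V.Poly K n) (α β γ : G2V.Mod K n r)
    (hα : α ∈ s.G) (hβ : β ∈ s.G) (hγ : γ ∈ s.G)
    (hpair : G2V.IsSPair m f a α b β)
    (hnext : G2V.IsNext m s (.jpair a α))
    (hne : γ ≠ β)
    (hred : G2V.IsRegularTopReducer m f (a • α) c γ)
    (hcan : ¬ G2V.Rewritable m s c γ) :
    G2V.Rewritable m s b β :=
  mainTheorem12_general hs hpair.isMonomial_right hred.1 hβ hγ hne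
    (hpair.degree_eq.symm.trans hred.degree_eq.symm)
    (fun p hp => hpair.sig_lt.trans_le (hnext.2 p hp))
    (fun p hp => hred.sig_lt.trans_le (hnext.2 p hp)) hcan
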